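/- Let $G$ be a group. A \emph{positive cone} of $G$ is a subsemigroup $P\subseteq G$ such that $G=P\sqcup P^{-1}\sqcup\{1\}$ (disjoint union); $G$ is \emph{left-orderable} if it has a positive cone. Let $X$ be a finite generating set of $G$ and let $\Gamma(G,X)$ be the Cayley graph (with $g$ adjacent to $gx^{\pm1}$, $x\in X$), with its combinatorial metric. For an integer $r\ge 1$, an \emph{$r$-path} is a finite nonempty sequence of vertices in which consecutive terms are at distance at most $r$. A set $S\subseteq G$ \emph{$r$-disconnects} $H_1,H_2\subseteq G$ if every $r$-path starting in $H_1$ and ending in $H_2$ contains a point of $S$; and $S$ \emph{$r$-disconnects} $P$ if there are $u,v\in P$ such that $S$ $r$-disconnects $\{u\}$ and $\{v\}$. A set $Y\subseteq G$ is \emph{coarsely connected} if there is $r\ge1$ such that any two points of $Y$ are joined by an $r$-path all of whose terms lie in $Y$. A finitely generated left-orderable group $G$ is \emph{Hucha with respect to} a family $\mathcal H$ of subgroups if for every finite generating set $X$, every positive cone $P$ of $G$, every $H\in\mathcal H$ and every integer $r>0$ there is a set $S\subseteq P^{-1}$ which, in $\Gamma(G,X)$, $r$-disconnects $P$ and also $r$-disconnects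 $g_1H$ and $g_2H$ for some $g_1,g_2\in G$. \textbf{Corollary.} Let $A$ and $B$ be non-trivial finitely generated groups. (1) If $A$ and $B$ are left-orderable, then the free product $A*B$ (is finitely generated, left-orderable and) is Hucha with respect to the family consisting of $A$, $B$ and all cyclic subgroups of $A*B$. (2) In particular, no positive cone of $A*B$ is coarsely connected in the Cayley graph of $A*B$ with respect to any finite generating set (so if $A*B$ is left-orderable, none of its positive cones is coarsely connected). -/

import Mathlib

open scoped Pointwise

namespace Hucha

/-- `P` is a positive cone of `G`: a subsemigroup such that `G` is the disjoint union of
`P`, `P⁻¹` and `{1}`. -/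
structure IsPositiveCone {G : Type*} [Group G] (P : Set G) : Prop where
  mul_mem : ∀ {a b : G}, a ∈ P → b ∈ P → a * b ∈ P
  one_notMem : (1 : G) ∉ P
  disjoint_inv : Disjoint P P⁻¹
  union_eq : P ∪ P⁻¹ ∪ {1} = Set.univ

/-- A group is left-orderable if it has a positive cone. -/
def IsLeftOrderable (G : Type*) [Group G] : Prop :=
  ∃ P : Set G, IsPositiveCone P

section Graph

variable {V : Type*}

/-- `γ 0, …, γ k` is an `r`-path of the graph `Γ`: consecutive vertices are at combinatorial
distance at most `r` (distance `∞` if there is no path). -/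
def IsRPath (Γ : SimpleGraph V) (r : ℕ) {k : ℕ} (γ : Fin (k + 1) → V) : Prop :=
  ∀ i : Fin k, Γ.edist (γ i.castSucc) (γ i.succ) ≤ (r : ℕ∞)

/-- `S` is coarsely connected: for some `r ≥ 1` any two points of `S` are the ends of an
`r`-path supported at `S`. -/
def CoarselyConnected (Γ : SimpleGraph V) (S : Set V) : Prop :=
  ∃ r : ℕ, 1 ≤ r ∧ ∀ u ∈ S, ∀ v ∈ S, ∃ (k : ℕ) (γ : Fin (k + 1) → V),
    IsRPath Γ r γ ∧ γ 0 = u ∧ γ (Fin.last k) = v ∧ ∀ i, γ i ∈ S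

/-- `S` `r`-disconnects `H₁` and `H₂`: every `r`-path from `H₁` to `H₂` meets `S`. -/
def RDisconnects (Γ : SimpleGraph V) (r : ℕ) (S H₁ H₂ : Set V) : Prop :=
  ∀ (k : ℕ) (γ : Fin (k + 1) → V), IsRPath Γ r γ → γ 0 ∈ H₁ → γ (Fin.last k) ∈ H₂ →
    ∃ i, γ i ∈ S

/-- `S` `r`-disconnects the set `P`: it `r`-disconnects two points of `P`. -/
def RDisconnectsSet (Γ : SimpleGraph V) (r : ℕ) (S P : Set V) : Prop :=
  ∃ u ∈ P, ∃ v ∈ P, RDisconnects Γ r S {u} {v}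

end Graph

section Group

variable {G : Type*} [Group G]

/-- `X` is a finite generating set of `G`. It need not be symmetric: `SimpleGraph.mulCayley X`
joins `g` to `g * x` and to `g * x⁻¹`, so it is also the Cayley graph of `X ∪ X⁻¹`. -/
def IsFiniteGenSet (X : Set G) : Prop :=
  X.Finite ∧ Subgroup.closure X = ⊤

/-- `S` is a negative swamp of width `r` for `H` in the graph `Γ` on `G`, with respect to
the positive cone `P`. -/
def IsNegativeSwamp (Γ : SimpleGraph G) (P : Set G) (H : Subgroup G) (r : ℕ) (S : Set G) :
    Prop :=
  S ⊆ P⁻¹ ∧ RDisconnectsSet Γ r S P ∧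
    ∃ g₁ g₂ : G, RDisconnects Γ r S (g₁ • (H : Set G)) (g₂ • (H : Set G))

/-- The Cayley graph `Γ` on `G` is Hucha with respect to the family `ℋ` of subgroups. -/
def GraphIsHucha (Γ : SimpleGraph G) (ℋ : Set (Subgroup G)) : Prop :=
  ∀ P : Set G, IsPositiveCone P → ∀ H ∈ ℋ, ∀ r : ℕ, 0 < r →
    ∃ S : Set G, IsNegativeSwamp Γ P H r S

end Group

/-- The group `G` is Hucha with respect to `ℋ`: it is finitely generated and left-orderable, and
its Cayley graphs with respect to finite generating sets are Hucha with respect to `ℋ`. -/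
def IsHucha (G : Type*) [Group G] (ℋ : Set (Subgroup G)) : Prop :=
  Group.FG G ∧ IsLeftOrderable G ∧
    ∀ X : Set G, IsFiniteGenSet X → GraphIsHucha (SimpleGraph.mulCayley X) ℋ

end Hucha

/-! Let `U` be the set of elements of `A * B` whose normal form begins in `A`. Right multiplication
by a fixed element changes membership in `U` at only finitely many points, so a finite set `D` meets
every `r`-path from `U` to its complement. In the left order (`x < y` when `x⁻¹ * y ∈ P`) the finite
set `D` has a strict upper bound `c`, hence `c⁻¹D` is negative. Non-trivial letters play ping-pong
with `U` and its complement, so both are unbounded above, and `c⁻¹D` separates two positive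
elements. To separate cosets of `H`, one coset on one side of `U` suffices, since ping-pong moves it
to the other side. For a factor this is immediate; a cyclic group lacking such a coset would have
finite index, and powers of elements of `A` and `B` would commute. A path inside `P` avoids `P⁻¹`,
which gives (2). Left-orderability comes from an odd integer weight on normal forms, additive up to
an error of one (`weight_triple`): positive weight defines a cone. -/

namespace Hucha

/-! ### Left orders: torsion-freeness and upper bounds -/

namespace IsPositiveCone

variable {G : Type*} [Group G] {P : Set G}

theorem mem_or_inv_mem (hP : IsPositiveCone P) {g : G} (hg : g ≠ 1) : g ∈ P ∨ g⁻¹ ∈ P := by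
  have h : g ∈ P ∪ P⁻¹ ∪ {1} := hP.union_eq ▸ Set.mem_univ g
  simpa [hg] using h

theorem inv_notMem (hP : IsPositiveCone P) {g : G} (hg : g ∈ P) : g⁻¹ ∉ P :=
  fun h => Set.disjoint_left.mp hP.disjoint_inv hg (Set.mem_inv.mpr h)

theorem pow_mem (hP : IsPositiveCone P) {g : G} (hg : g ∈ P) (n : ℕ) : g ^ (n + 1) ∈ P := by
  induction n with
  | zero => simpa using hg
  | succ n ih => rw [pow_succ]; exact hP.mul_mem ih hg

/-- A group with a positive cone is torsion-free. -/
theorem pow_ne_one (hP : IsPositiveCone P) {g : G} (hg : g ≠ 1) (n : ℕ) : g ^ (n + 1) ≠ 1 := by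
  intro h
  rcases hP.mem_or_inv_mem hg with h' | h'
  · exact hP.one_notMem (h ▸ hP.pow_mem h' n)
  · exact hP.one_notMem (by simpa [h] using hP.pow_mem h' n)

theorem zpow_ne_one (hP : IsPositiveCone P) {g : G} (hg : g ≠ 1) {n : ℤ} (hn : n ≠ 0) :
    g ^ n ≠ 1 := by
  obtain ⟨m, rfl | rfl⟩ := n.eq_nat_or_neg
  all_goals
    obtain ⟨k, rfl⟩ := Nat.exists_eq_succ_of_ne_zero (n := m) (by simpa using hn)
    simpa only [zpow_neg, zpow_natCast, ne_eq, inv_eq_one] using hP.pow_ne_one hg k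

theorem lt_trans (hP : IsPositiveCone P) {a b c : G} (hab : a⁻¹ * b ∈ P) (hbc : b⁻¹ * c ∈ P) :
    a⁻¹ * c ∈ P := by
  simpa [mul_assoc] using hP.mul_mem hab hbc

theorem nonempty (hP : IsPositiveCone P) [Nontrivial G] : P.Nonempty := by
  obtain ⟨g, hg⟩ := exists_ne (1 : G)
  exact (hP.mem_or_inv_mem hg).elim (fun h => ⟨_, h⟩) fun h => ⟨_, h⟩

/-- Finite sets are strictly bounded above. -/
theorem exists_upper_bound (hP : IsPositiveCone P) [Nontrivial G] {D : Set G} (hD : D.Finite) :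
    ∃ c, ∀ d ∈ D, d⁻¹ * c ∈ P := by
  obtain ⟨p, hp⟩ := hP.nonempty
  induction D, hD using Set.Finite.induction_on with
  | empty => exact ⟨1, by simp⟩
  | @insert d D _ _ ih =>
    obtain ⟨c, hc⟩ := ih
    have hp' : ∀ x : G, x⁻¹ * (x * p) ∈ P := fun x => by simpa using hp
    -- The bound must be strict, so the maximum of `c` and `d` is increased by a positive `p` unless
    -- `c` is already above `d`.
    by_cases hdc : d⁻¹ * c = 1
    · have : d = c := by simpa [inv_mul_eq_one] using hdc
      refine ⟨c * p, ?_⟩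
      rintro x (rfl | hx)
      · rw [this]; exact hp' c
      · exact hP.lt_trans (hc x hx) (hp' c)
    · rcases hP.mem_or_inv_mem hdc with h | h
      · refine ⟨c, ?_⟩
        rintro x (rfl | hx)
        exacts [h, hc x hx]
      · refine ⟨d * p, ?_⟩
        rintro x (rfl | hx)
        · exact hp' x
        · exact hP.lt_trans (hc x hx) (hP.lt_trans (by simpa using h) (hp' d))

/-- A positive cone restricts along an injective homomorphism. -/
theorem preimage (hP : IsPositiveCone P) {H : Type*} [Group H] (f : H →* G)
    (hf : Function.Injective f) : IsPositiveCone (f ⁻¹' P) where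
  mul_mem ha hb := by simpa using hP.mul_mem ha hb
  one_notMem := by simpa using hP.one_notMem
  disjoint_inv := Set.disjoint_left.mpr fun x hx hx' => hP.inv_notMem hx (by simpa using hx')
  union_eq := by
    ext x
    by_cases hx : x = 1
    · simp [hx]
    · simpa [hx] using hP.mem_or_inv_mem ((map_ne_one_iff f hf).mpr hx)

end IsPositiveCone

/-! ### The first letter of a normal form, read by an action -/

section FirstLetter

open Monoid.Coprod

variable {A B : Type*} [Group A] [Group B]

open Classical in
/-- The cocycle `(g, x) ↦ [x = 1] + [x g⁻¹ = 1]` as an action of a group on `G × Bool`. -/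
noncomputable def flipAction (G : Type*) [Group G] : G →* Function.End (G × Bool) where
  toFun g p := (p.1 * g⁻¹, p.2 ^^ decide (p.1 = 1) ^^ decide (p.1 * g⁻¹ = 1))
  map_one' := by funext ⟨x, t⟩; simp [Function.End.one_def]
  -- The indicator of the intermediate point `x * h⁻¹` occurs twice and cancels.
  map_mul' g h := by
    funext ⟨x, t⟩
    change _ = (x * h⁻¹ * g⁻¹, (t ^^ decide (x = 1) ^^ decide (x * h⁻¹ = 1)) ^^
      decide (x * h⁻¹ = 1) ^^ decide (x * h⁻¹ * g⁻¹ = 1))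
    simp [mul_assoc]

/-- The action of a group on the first factor of `G × Bool`. -/
def mulAction (G : Type*) [Group G] : G →* Function.End (G × Bool) where
  toFun g p := (p.1 * g⁻¹, p.2)
  map_one' := by funext ⟨x, t⟩; simp [Function.End.one_def]
  map_mul' g h := by
    funext ⟨x, t⟩
    change _ = (x * h⁻¹ * g⁻¹, t)
    simp [mul_assoc]

variable (A B) in
/-- The action of `A * B` on `(A * B) × Bool` in which `A` flips the second coordinate when it
moves an element to or from `1`. -/
noncomputable def letterAction :
    Monoid.Coprod A B →* Function.End (Monoid.Coprod A B × Bool) :=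
  lift ((flipAction _).comp inl) ((mulAction _).comp inr)

variable (A B) in
/-- The elements of `A * B` whose normal form begins with a letter of `A`. -/
def startsInl : Set (Monoid.Coprod A B) := {x | (letterAction A B x⁻¹ (1, false)).2 = true}

theorem letterAction_one (p : Monoid.Coprod A B × Bool) : letterAction A B 1 p = p := by
  rw [map_one]; rfl

open Classical in
theorem letterAction_inl_mul (a : A) (x : Monoid.Coprod A B) (p : Monoid.Coprod A B × Bool) :
    letterAction A B (inl a * x) p =
      ((letterAction A B x p).1 * (inl a)⁻¹, (letterAction A B x p).2 ^^
        decide ((letterAction A B x p).1 = 1) ^^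
          decide ((letterAction A B x p).1 * (inl a)⁻¹ = 1)) := by
  rw [map_mul]; rfl

theorem letterAction_inr_mul (b : B) (x : Monoid.Coprod A B) (p : Monoid.Coprod A B × Bool) :
    letterAction A B (inr b * x) p =
      ((letterAction A B x p).1 * (inr b)⁻¹, (letterAction A B x p).2) := by
  rw [map_mul]; rfl

/-- Acting by `x⁻¹` from `1` therefore visits the prefixes of a word for `x`. Along a normal form
only the first step touches `1`, so the bit records whether that step lies in `A`; since the action
is well defined, no normal forms are needed. -/
theorem letterAction_fst (g : Monoid.Coprod A B) (p : Monoid.Coprod A B × Bool) :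
    (letterAction A B g p).1 = p.1 * g⁻¹ := by
  induction g using induction_on' with
  | one => simp [letterAction_one]
  | inl_mul a x ih => simp [letterAction_inl_mul, ih, mul_assoc]
  | inr_mul b x ih => simp [letterAction_inr_mul, ih, mul_assoc]

theorem mem_startsInl {x : Monoid.Coprod A B} :
    x ∈ startsInl A B ↔ (letterAction A B x⁻¹ (1, false)).2 = true := Iff.rfl

theorem one_notMem_startsInl : (1 : Monoid.Coprod A B) ∉ startsInl A B := by
  simp [mem_startsInl, letterAction_one]

theorem mul_inr_mem_startsInl {x : Monoid.Coprod A B} {b : B} :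
    x * inr b ∈ startsInl A B ↔ x ∈ startsInl A B := by
  rw [mem_startsInl, mem_startsInl, mul_inv_rev, ← map_inv, letterAction_inr_mul]

theorem mul_inl_mem_startsInl {x : Monoid.Coprod A B} {a : A} (hx : x ≠ 1) (hxa : x * inl a ≠ 1) :
    x * inl a ∈ startsInl A B ↔ x ∈ startsInl A B := by
  have hxa' : x * (inl a⁻¹)⁻¹ ≠ 1 := by rwa [map_inv, inv_inv]
  rw [mem_startsInl, mem_startsInl, mul_inv_rev, ← map_inv, letterAction_inl_mul,
    letterAction_fst, one_mul, inv_inv]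
  simp only [hx, hxa', decide_false, Bool.xor_false]

theorem inl_mem_startsInl {a : A} (ha : a ≠ 1) : (inl a : Monoid.Coprod A B) ∈ startsInl A B := by
  have ha' : (inl a⁻¹ : Monoid.Coprod A B)⁻¹ ≠ 1 := by
    rw [map_inv, inv_inv]; exact (map_ne_one_iff _ inl_injective).mpr ha
  rw [mem_startsInl, ← map_inv, ← mul_one (inl a⁻¹), letterAction_inl_mul, letterAction_one]
  simp only [one_mul, ha', decide_false, decide_true, Bool.xor_false, Bool.xor_true, Bool.not_false]

theorem inr_notMem_startsInl (b : B) : (inr b : Monoid.Coprod A B) ∉ startsInl A B := by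
  simpa using (mul_inr_mem_startsInl (A := A) (x := 1) (b := b)).not.mpr one_notMem_startsInl

theorem inr_mul_inl_ne_one {b : B} (hb : b ≠ 1) (a : A) :
    (inr b * inl a : Monoid.Coprod A B) ≠ 1 := fun h => hb (by simpa using congrArg snd h)

theorem inr_mul_inl_notMem_startsInl {b : B} (hb : b ≠ 1) (a : A) :
    (inr b * inl a : Monoid.Coprod A B) ∉ startsInl A B := by
  rw [mul_inl_mem_startsInl ((map_ne_one_iff _ inr_injective).mpr hb) (inr_mul_inl_ne_one hb a)]
  exact inr_notMem_startsInl b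

/-- Appending letters on the right leaves the first letter alone except near `1`, so this is the
induction suited to `startsInl`. -/
theorem coprod_induction_right {motive : Monoid.Coprod A B → Prop} (x : Monoid.Coprod A B)
    (one : motive 1) (mul_inl : ∀ x a, motive x → motive (x * inl a))
    (mul_inr : ∀ x b, motive x → motive (x * inr b)) : motive x := by
  suffices ∀ y : Monoid.Coprod A B, motive y⁻¹ by simpa using this x⁻¹
  intro y
  induction y using induction_on' with
  | one => simpa
  | inl_mul a y ih => simpa using mul_inl _ a⁻¹ ih
  | inr_mul b y ih => simpa using mul_inr _ b⁻¹ ih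

/-- Multiplication by a non-trivial element of `A` maps the complement of `startsInl` into it. -/
theorem inl_mul_mem_startsInl {a : A} (ha : a ≠ 1) {x : Monoid.Coprod A B}
    (hx : x ∉ startsInl A B) : inl a * x ∈ startsInl A B := by
  -- The disjunction survives appending a letter, because both memberships do unless one of the
  -- products involved is `1`; those cases are checked by hand.
  suffices x ∈ startsInl A B ∨ inl a * x ∈ startsInl A B from this.resolve_left hx
  clear hx
  induction x using coprod_induction_right with
  | one => right; simpa using inl_mem_startsInl ha
  | mul_inr x b ih => simpa only [← mul_assoc, mul_inr_mem_startsInl] using ih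
  | mul_inl x a' ih =>
    by_cases h1 : x = 1
    · by_cases ha' : a' = 1
      · simpa [ha'] using ih
      · left; simpa [h1] using inl_mem_startsInl ha'
    by_cases h2 : x * inl a' = 1
    · right; simpa [h2] using inl_mem_startsInl ha
    by_cases h3 : inl a * x = 1
    · obtain rfl : x = inl a⁻¹ := by rw [map_inv]; exact (inv_eq_of_mul_eq_one_right h3).symm
      left
      rw [← map_mul] at h2 ⊢
      exact inl_mem_startsInl ((map_ne_one_iff _ inl_injective).mp h2)
    by_cases h4 : inl a * x * inl a' = 1
    · left
      have : x * inl a' = inl a⁻¹ := by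
        rw [map_inv]; rw [mul_assoc] at h4; exact (inv_eq_of_mul_eq_one_right h4).symm
      rw [this]
      exact inl_mem_startsInl (inv_ne_one.mpr ha)
    rwa [mul_inl_mem_startsInl h1 h2, ← mul_assoc, mul_inl_mem_startsInl h3 h4]

/-- Multiplication by a non-trivial element of `B` maps `startsInl` into its complement. -/
theorem inr_mul_notMem_startsInl {b : B} (hb : b ≠ 1) {x : Monoid.Coprod A B}
    (hx : x ∈ startsInl A B) : inr b * x ∉ startsInl A B := by
  suffices x ∉ startsInl A B ∨ inr b * x ∉ startsInl A B from this.resolve_left (not_not.mpr hx)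
  clear hx
  induction x using coprod_induction_right with
  | one => left; exact one_notMem_startsInl
  | mul_inr x b ih => simpa only [← mul_assoc, mul_inr_mem_startsInl] using ih
  | mul_inl x a' ih =>
    by_cases h1 : x = 1
    · right; simpa [h1] using inr_mul_inl_notMem_startsInl hb a'
    by_cases h2 : x * inl a' = 1
    · left; rw [h2]; exact one_notMem_startsInl
    by_cases h3 : inr b * x = 1
    · obtain rfl : x = inr b⁻¹ := by rw [map_inv]; exact (inv_eq_of_mul_eq_one_right h3).symm
      left
      exact inr_mul_inl_notMem_startsInl (inv_ne_one.mpr hb) a'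
    by_cases h4 : inr b * x * inl a' = 1
    · right; rw [← mul_assoc, h4]; exact one_notMem_startsInl
    rwa [mul_inl_mem_startsInl h1 h2, ← mul_assoc, mul_inl_mem_startsInl h3 h4]

/-- `startsInl` is almost invariant under right multiplication. -/
theorem finite_boundary_startsInl (f : Monoid.Coprod A B) :
    {x | ¬ (x ∈ startsInl A B ↔ x * f ∈ startsInl A B)}.Finite := by
  induction f using coprod_induction_right with
  | one => simp
  | mul_inr f b ih => simpa only [← mul_assoc, mul_inr_mem_startsInl] using ih
  | mul_inl f a ih =>
    -- The extra letter matters only if `x * f` or `x * f * inl a` is `1`.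
    refine (ih.union (Set.toFinite {f⁻¹, (f * inl a)⁻¹})).subset fun x hx => ?_
    by_cases h1 : x * f = 1
    · right; left; exact eq_inv_of_mul_eq_one_left h1
    by_cases h2 : x * f * inl a = 1
    · right; right; exact eq_inv_of_mul_eq_one_left (by rwa [← mul_assoc])
    left
    simpa only [Set.mem_ofPred_eq, ← mul_assoc, mul_inl_mem_startsInl h1 h2] using hx

theorem inl_mul_inr_ne {a : A} {b : B} (ha : a ≠ 1) (hb : b ≠ 1) :
    (inl a * inr b : Monoid.Coprod A B) ≠ inr b * inl a := fun h =>
  inr_mul_inl_notMem_startsInl hb a (h ▸ mul_inr_mem_startsInl.mpr (inl_mem_startsInl ha))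

end FirstLetter

end Hucha

/-! ### Finite separators and negative swamps -/

namespace Hucha

/-- Balls in the Cayley graph of a finite generating set are finite. -/
theorem exists_finite_steps {G : Type*} [Group G] {X : Set G} (hX : X.Finite) (r : ℕ) :
    ∃ F : Set G, F.Finite ∧
      ∀ x y, (SimpleGraph.mulCayley X).edist x y ≤ (r : ℕ∞) → x⁻¹ * y ∈ F := by
  set T : Set G := insert 1 (X ∪ X⁻¹) with hT
  have hTf : T.Finite := (hX.union hX.inv).insert 1
  have hwalk : ∀ {x y : G} (p : (SimpleGraph.mulCayley X).Walk x y), x⁻¹ * y ∈ T ^ p.length := by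
    intro x y p
    induction p with
    | nil => simp
    | @cons u v w h p ih =>
      have huv : u⁻¹ * v ∈ T := by
        obtain ⟨-, g, hg, rfl | rfl⟩ := (SimpleGraph.mulCayley_adj' X _ _).mp h
        · simp [hT, hg]
        · simp [hT, hg]
      rw [SimpleGraph.Walk.length_cons, pow_succ']
      exact Set.mem_mul.mpr ⟨_, huv, _, ih, by group⟩
  have hpow : ∀ n : ℕ, (T ^ n).Finite := fun n => by
    induction n with
    | zero => simp
    | succ n ih => rw [pow_succ]; exact ih.mul hTf
  refine ⟨T ^ r, hpow r, fun x y h => ?_⟩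
  obtain ⟨p, hp⟩ := SimpleGraph.exists_walk_of_edist_ne_top
    (ne_top_of_le_ne_top (ENat.natCast_ne_top r) h)
  rw [← hp] at h
  exact Set.pow_subset_pow_right (Set.mem_insert _ _) (by exact_mod_cast h) (hwalk p)

theorem exists_consecutive {k : ℕ} (p : Fin (k + 1) → Prop) (h0 : p 0) (hk : ¬ p (Fin.last k)) :
    ∃ i : Fin k, p i.castSucc ∧ ¬ p i.succ := by
  by_contra! h
  exact hk (Fin.induction (motive := p) h0 h (Fin.last k))

open Monoid.Coprod

variable {A B : Type*} [Group A] [Group B]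

/-- A finite set that `r`-disconnects `startsInl` from its complement, along with its translates. -/
theorem exists_finite_separator {X : Set (Monoid.Coprod A B)} (hX : X.Finite) (r : ℕ) :
    ∃ D : Set (Monoid.Coprod A B), D.Finite ∧ ∀ (c : Monoid.Coprod A B) (H₁ H₂ : Set _),
      (∀ x ∈ H₁, c⁻¹ * x ∈ startsInl A B) → (∀ x ∈ H₂, c⁻¹ * x ∉ startsInl A B) →
        RDisconnects (SimpleGraph.mulCayley X) r (c • D) H₁ H₂ := by
  obtain ⟨F, hF, hstep⟩ := exists_finite_steps hX r
  -- A path leaving the translate of `startsInl` by `c` does so by a step `f ∈ F`, and the vertex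
  -- before that step lies in `c • D`.
  refine ⟨⋃ f ∈ F, {x | ¬ (x ∈ startsInl A B ↔ x * f ∈ startsInl A B)},
    hF.biUnion fun f _ => finite_boundary_startsInl f, fun c H₁ H₂ h₁ h₂ k γ hγ h0 hk => ?_⟩
  obtain ⟨i, hi, hi'⟩ := exists_consecutive (fun i => c⁻¹ * γ i ∈ startsInl A B)
    (h₁ _ h0) (h₂ _ hk)
  refine ⟨i.castSucc, Set.mem_smul_set_iff_inv_smul_mem.mpr (Set.mem_biUnion (hstep _ _ (hγ i)) ?_)⟩
  have he : c⁻¹ * γ i.castSucc * ((γ i.castSucc)⁻¹ * γ i.succ) = c⁻¹ * γ i.succ := by group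
  simp only [Set.mem_ofPred_eq, smul_eq_mul, he]
  tauto

/-- `startsInl` has elements above any given one. -/
theorem exists_mem_startsInl_gt [Nontrivial A] {P : Set (Monoid.Coprod A B)}
    (hP : IsPositiveCone P) (c : Monoid.Coprod A B) : ∃ u ∈ startsInl A B, c⁻¹ * u ∈ P := by
  obtain ⟨a, ha⟩ := exists_ne (1 : A)
  have : Nontrivial (Monoid.Coprod A B) := (inl_injective (M := A) (N := B)).nontrivial
  -- By left invariance both `m` and `inl a * m` exceed `c`, and one of them is in `startsInl`.
  obtain ⟨m, hm⟩ := hP.exists_upper_bound (Set.toFinite {c, inl a⁻¹ * c})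
  by_cases hmU : m ∈ startsInl A B
  · exact ⟨m, hmU, hm _ (by simp)⟩
  · refine ⟨inl a * m, inl_mul_mem_startsInl ha hmU, ?_⟩
    have := hm (inl a⁻¹ * c) (by simp)
    rwa [map_inv, mul_inv_rev, inv_inv, mul_assoc] at this

/-- The complement of `startsInl` has elements above any given one. -/
theorem exists_notMem_startsInl_gt [Nontrivial B] {P : Set (Monoid.Coprod A B)}
    (hP : IsPositiveCone P) (c : Monoid.Coprod A B) : ∃ v ∉ startsInl A B, c⁻¹ * v ∈ P := by
  obtain ⟨b, hb⟩ := exists_ne (1 : B)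
  have : Nontrivial (Monoid.Coprod A B) := (inr_injective (M := A) (N := B)).nontrivial
  obtain ⟨m, hm⟩ := hP.exists_upper_bound (Set.toFinite {c, inr b⁻¹ * c})
  by_cases hmU : m ∈ startsInl A B
  · refine ⟨inr b * m, inr_mul_notMem_startsInl hb hmU, ?_⟩
    have := hm (inr b⁻¹ * c) (by simp)
    rwa [map_inv, mul_inv_rev, inv_inv, mul_assoc] at this
  · exact ⟨m, hmU, hm _ (by simp)⟩

/-- A subgroup with one coset on one side of `startsInl` has cosets on both sides. -/
theorem exists_cosets_of_coset [Nontrivial A] [Nontrivial B] {H : Subgroup (Monoid.Coprod A B)}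
    {g : Monoid.Coprod A B}
    (h : (∀ x ∈ H, g * x ∈ startsInl A B) ∨ ∀ x ∈ H, g * x ∉ startsInl A B) :
    ∃ g₁ g₂ : Monoid.Coprod A B,
      (∀ x ∈ H, g₁ * x ∈ startsInl A B) ∧ ∀ x ∈ H, g₂ * x ∉ startsInl A B := by
  obtain ⟨a, ha⟩ := exists_ne (1 : A)
  obtain ⟨b, hb⟩ := exists_ne (1 : B)
  rcases h with h | h
  · refine ⟨g, inr b * g, h, fun x hx => ?_⟩
    rw [mul_assoc]; exact inr_mul_notMem_startsInl hb (h x hx)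
  · refine ⟨inl a * g, g, fun x hx => ?_, h⟩
    rw [mul_assoc]; exact inl_mul_mem_startsInl ha (h x hx)

theorem exists_coset_range_inl [Nontrivial B] : ∃ g : Monoid.Coprod A B,
    ∀ x ∈ (inl : A →* Monoid.Coprod A B).range, g * x ∉ startsInl A B := by
  obtain ⟨b, hb⟩ := exists_ne (1 : B)
  refine ⟨inr b, ?_⟩
  rintro _ ⟨a, rfl⟩
  exact inr_mul_inl_notMem_startsInl hb a

theorem exists_coset_range_inr [Nontrivial A] : ∃ g : Monoid.Coprod A B,
    ∀ x ∈ (inr : B →* Monoid.Coprod A B).range, g * x ∈ startsInl A B := by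
  obtain ⟨a, ha⟩ := exists_ne (1 : A)
  refine ⟨inl a, ?_⟩
  rintro _ ⟨b, rfl⟩
  exact mul_inr_mem_startsInl.mpr (inl_mem_startsInl ha)

/-- If finitely many cosets of `H` cover a group, then every element has a power with non-zero
exponent in `H`. -/
theorem exists_zpow_mem_of_finite_cover {G : Type*} [Group G] {D : Set G} (hD : D.Finite)
    {H : Subgroup G} (hcov : ∀ g : G, ∃ x ∈ H, g * x ∈ D) (y : G) :
    ∃ n : ℤ, n ≠ 0 ∧ y ^ n ∈ H := by
  choose f hf hfD using hcov
  have := hD.to_subtype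
  -- Pigeonhole: the cosets of two distinct powers of `y` share a point of `D`.
  obtain ⟨i, j, hij, he⟩ := Finite.exists_ne_map_eq_of_infinite
    fun n : ℤ => (⟨_, hfD (y ^ n)⟩ : D)
  have he' : y ^ i * f (y ^ i) = y ^ j * f (y ^ j) := congrArg Subtype.val he
  refine ⟨-j + i, by omega, ?_⟩
  have : y ^ (-j + i) = f (y ^ j) * (f (y ^ i))⁻¹ := by
    rw [eq_mul_inv_iff_mul_eq, zpow_add, mul_assoc, he', zpow_neg, inv_mul_cancel_left]
  rw [this]
  exact H.mul_mem (hf _) (H.inv_mem (hf _))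

/-- If some coset of `H` misses the finite boundary of `startsInl` for the generator `h`, walking
along it by `h` never changes sides. Otherwise that boundary meets every coset, and the abelian
group `H` contains non-trivial powers of a letter of `A` and of a letter of `B`, which do not
commute. -/
theorem exists_coset_cyclic [Nontrivial A] [Nontrivial B] {P : Set (Monoid.Coprod A B)}
    (hP : IsPositiveCone P) {H : Subgroup (Monoid.Coprod A B)} [IsCyclic H] :
    ∃ g : Monoid.Coprod A B,
      (∀ x ∈ H, g * x ∈ startsInl A B) ∨ ∀ x ∈ H, g * x ∉ startsInl A B := by
  obtain ⟨h, hH⟩ := (Subgroup.isCyclic_iff_exists_zpowers_eq_top H).mp ‹_›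
  obtain ⟨g, hg⟩ : ∃ g : Monoid.Coprod A B, ∀ x ∈ H,
      (g * x ∈ startsInl A B ↔ g * x * h ∈ startsInl A B) := by
    by_contra! hcon
    have hcov := exists_zpow_mem_of_finite_cover (finite_boundary_startsInl h) (H := H)
      fun g => by
        obtain ⟨x, hx, hx'⟩ := hcon g
        refine ⟨x, hx, ?_⟩
        simp only [Set.mem_ofPred_eq]
        tauto
    obtain ⟨a, ha⟩ := exists_ne (1 : A)
    obtain ⟨b, hb⟩ := exists_ne (1 : B)
    obtain ⟨m, hm, hma⟩ := hcov (inl a)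
    obtain ⟨n, hn, hnb⟩ := hcov (inr b)
    rw [← map_zpow] at hma hnb
    refine inl_mul_inr_ne (a := a ^ m) (b := b ^ n)
      ((hP.preimage inl inl_injective).zpow_ne_one ha hm)
      ((hP.preimage inr inr_injective).zpow_ne_one hb hn) ?_
    rw [← hH] at hma hnb
    obtain ⟨i, hi⟩ := hma
    obtain ⟨j, hj⟩ := hnb
    rw [← hi, ← hj]
    exact (Commute.refl h).zpow_zpow i j
  have key : ∀ n : ℤ, g * h ^ n ∈ startsInl A B ↔ g ∈ startsInl A B := by
    have hstep : ∀ n : ℤ, g * h ^ n ∈ startsInl A B ↔ g * h ^ (n + 1) ∈ startsInl A B := fun n => by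
      rw [zpow_add_one, ← mul_assoc]
      exact hg _ (hH ▸ Subgroup.zpow_mem_zpowers h n)
    intro n
    induction n using Int.induction_on with
    | zero => simp
    | succ n ih => rw [← hstep, ih]
    | pred n ih => rw [hstep, sub_add_cancel, ih]
  subst hH
  refine ⟨g, ?_⟩
  by_cases hgU : g ∈ startsInl A B
  · left
    rintro _ ⟨n, rfl⟩
    exact (key n).mpr hgU
  · right
    rintro _ ⟨n, rfl⟩
    exact fun hx => hgU ((key n).mp hx)

/-- A subgroup with a coset on one side of `startsInl` has negative swamps of any width. -/
theorem exists_negativeSwamp [Nontrivial A] [Nontrivial B] {X P : Set (Monoid.Coprod A B)}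
    (hX : X.Finite) (hP : IsPositiveCone P) {H : Subgroup (Monoid.Coprod A B)}
    {g : Monoid.Coprod A B}
    (h : (∀ x ∈ H, g * x ∈ startsInl A B) ∨ ∀ x ∈ H, g * x ∉ startsInl A B) (r : ℕ) :
    ∃ S, IsNegativeSwamp (SimpleGraph.mulCayley X) P H r S := by
  have : Nontrivial (Monoid.Coprod A B) := (inl_injective (M := A) (N := B)).nontrivial
  obtain ⟨D, hD, hsep⟩ := exists_finite_separator hX r
  obtain ⟨c, hc⟩ := hP.exists_upper_bound hD
  obtain ⟨u, hu, huc⟩ := exists_mem_startsInl_gt hP c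
  obtain ⟨v, hv, hvc⟩ := exists_notMem_startsInl_gt hP c
  obtain ⟨g₁, g₂, h₁, h₂⟩ := exists_cosets_of_coset h
  -- Translating by `c⁻¹` makes `D`, below `c`, negative and `u`, `v`, above `c`, positive.
  refine ⟨c⁻¹ • D, ?_, ⟨_, huc, _, hvc, hsep _ _ _ ?_ ?_⟩, c⁻¹ * g₁, c⁻¹ * g₂, hsep _ _ _ ?_ ?_⟩
  · rintro _ ⟨d, hd, rfl⟩
    simpa using hc d hd
  · rintro _ rfl; simpa using hu
  · rintro _ rfl; simpa using hv
  · rintro _ ⟨x, hx, rfl⟩; simpa [mul_assoc] using h₁ x hx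
  · rintro _ ⟨x, hx, rfl⟩; simpa [mul_assoc] using h₂ x hx

theorem exists_negativeSwamp_range_inl [Nontrivial A] [Nontrivial B]
    {X P : Set (Monoid.Coprod A B)} (hX : X.Finite) (hP : IsPositiveCone P) (r : ℕ) :
    ∃ S, IsNegativeSwamp (SimpleGraph.mulCayley X) P (inl : A →* Monoid.Coprod A B).range r S :=
  let ⟨_, hg⟩ := exists_coset_range_inl (A := A) (B := B)
  exists_negativeSwamp hX hP (Or.inr hg) r

theorem coprod_graphIsHucha [Nontrivial A] [Nontrivial B] {X : Set (Monoid.Coprod A B)}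
    (hX : X.Finite) : GraphIsHucha (SimpleGraph.mulCayley X)
      ({(inl : A →* Monoid.Coprod A B).range, (inr : B →* Monoid.Coprod A B).range} ∪
        {C : Subgroup (Monoid.Coprod A B) | IsCyclic C}) := by
  rintro P hP H ((rfl | rfl) | hH) r -
  · exact exists_negativeSwamp_range_inl hX hP r
  · obtain ⟨g, hg⟩ := exists_coset_range_inr (A := A) (B := B)
    exact exists_negativeSwamp hX hP (Or.inl hg) r
  · have : IsCyclic H := hH
    obtain ⟨g, hg⟩ := exists_coset_cyclic hP (H := H)
    exact exists_negativeSwamp hX hP hg r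

/-- A positive cone that is disconnected by negative sets at every scale is not coarsely
connected. -/
theorem IsPositiveCone.not_coarselyConnected {G : Type*} [Group G] {P : Set G}
    (hP : IsPositiveCone P) {Γ : SimpleGraph G} {H : Subgroup G}
    (h : ∀ r, ∃ S, IsNegativeSwamp Γ P H r S) : ¬ CoarselyConnected Γ P := by
  rintro ⟨r, -, hr⟩
  obtain ⟨S, hS, ⟨u, hu, v, hv, hd⟩, -⟩ := h r
  obtain ⟨k, γ, hγ, h0, hk, hmem⟩ := hr u hu v hv
  obtain ⟨i, hi⟩ := hd k γ hγ h0 hk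
  exact Set.disjoint_left.mp hP.disjoint_inv (hmem i) (hS hi)

theorem coprod_fg [Group.FG A] [Group.FG B] : Group.FG (Monoid.Coprod A B) := by
  rw [Group.fg_def, ← range_inl_sup_range_inr]
  exact Subgroup.FG.sup ((Group.fg_iff_subgroup_fg _).mp inferInstance)
    ((Group.fg_iff_subgroup_fg _).mp inferInstance)

end Hucha

/-! ### A weight on normal forms and the cone it defines -/

namespace Hucha

/-- The sign of a group element with respect to a positive cone. -/
noncomputable def coneSign {G : Type*} [Group G] (P : Set G) (g : G) : ℤ :=
  open Classical in if g ∈ P then 1 else if g⁻¹ ∈ P then -1 else 0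

section Sign

variable {G : Type*} [Group G] {P : Set G}

theorem coneSign_eq_or (hP : IsPositiveCone P) {g : G} (hg : g ≠ 1) :
    coneSign P g = 1 ∧ g ∈ P ∨ coneSign P g = -1 ∧ g⁻¹ ∈ P := by
  rcases hP.mem_or_inv_mem hg with h | h
  · left; simp [coneSign, h]
  · right
    have : g ∉ P := by simpa using hP.inv_notMem h
    simp [coneSign, h, this]

theorem coneSign_inv (hP : IsPositiveCone P) {g : G} (hg : g ≠ 1) :
    coneSign P g⁻¹ = - coneSign P g := by
  rcases coneSign_eq_or hP hg with ⟨h, h'⟩ | ⟨h, h'⟩ <;>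
    rcases coneSign_eq_or hP (inv_ne_one.mpr hg) with ⟨k, k'⟩ | ⟨k, k'⟩
  · exact absurd k' (hP.inv_notMem h')
  · omega
  · omega
  · exact absurd k' (hP.inv_notMem h')

/-- A sum of three signs is `±1` or `±3`; the values `±3` would mean `1 < g < h < 1` or its reverse.
-/
theorem coneSign_triple (hP : IsPositiveCone P) {g h : G} (hg : g ≠ 1) (hh : h ≠ 1) (hgh : g ≠ h) :
    coneSign P (g⁻¹ * h) - coneSign P h + coneSign P g = 1 ∨
      coneSign P (g⁻¹ * h) - coneSign P h + coneSign P g = -1 := by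
  rcases coneSign_eq_or hP hg with ⟨h1, h1'⟩ | ⟨h1, h1'⟩ <;>
    rcases coneSign_eq_or hP hh with ⟨h2, h2'⟩ | ⟨h2, h2'⟩ <;>
    rcases coneSign_eq_or hP (inv_mul_eq_one.not.mpr hgh) with ⟨h3, h3'⟩ | ⟨h3, h3'⟩ <;>
    try omega
  · have := hP.mul_mem h1' h3'
    rw [mul_inv_cancel_left] at this
    exact absurd h2' (hP.inv_notMem this)
  · have := hP.mul_mem h3' h1'
    rw [mul_inv_rev, inv_inv, mul_inv_cancel_right] at this
    exact absurd this (by simpa using hP.inv_notMem h2')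

end Sign

/-- A decomposition of `G` that makes it the free product of the subgroups `K true` and `K false`:
`U i` is the set of elements whose normal form begins with a letter of `K i`. -/
structure IsFreeDecomposition {G : Type*} [Group G] (K : Bool → Subgroup G) (U : Bool → Set G) :
    Prop where
  one_notMem : ∀ i, 1 ∉ U i
  notMem_not : ∀ {i x}, x ∈ U i → x ∉ U (!i)
  mem_or : ∀ {x}, x ≠ 1 → ∀ i, x ∈ U i ∨ x ∈ U (!i)
  mul_mem : ∀ {i k x}, k ∈ K i → k ≠ 1 → x ∉ U i → k * x ∈ U i
  induction : ∀ motive : G → Prop, motive 1 → (∀ i, ∀ k ∈ K i, ∀ x, motive x → motive (k * x)) →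
    ∀ x, motive x

/-- The orientation of the turn from a letter of `K i` to a letter of `K (!i)`. -/
def turn (i : Bool) : ℤ := if i then 1 else -1

theorem turn_not (i : Bool) : turn (!i) = - turn i := by cases i <;> rfl

theorem turn_eq_or (i : Bool) : turn i = 1 ∨ turn i = -1 := by cases i <;> simp [turn]

/-- `HasWeight K U s g n`: `n` is the sum of the signs of the letters of `g` and of the orientations
of the turns of the normal form of `g`. -/
inductive HasWeight {G : Type*} [Group G] (K : Bool → Subgroup G) (U : Bool → Set G)
    (s : Bool → G → ℤ) : G → ℤ → Prop
  | one : HasWeight K U s 1 0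
  | single (i : Bool) (k : G) : k ∈ K i → k ≠ 1 → HasWeight K U s k (s i k)
  | cons (i : Bool) (k x : G) (n : ℤ) : k ∈ K i → k ≠ 1 → x ∈ U (!i) → HasWeight K U s x n →
      HasWeight K U s (k * x) (s i k + n + turn i)

namespace IsFreeDecomposition

variable {G : Type*} [Group G] {K : Bool → Subgroup G} {U : Bool → Set G} {s : Bool → G → ℤ}

theorem notMem (h : IsFreeDecomposition K U) {i : Bool} {x : G} (hx : x ∈ U (!i)) : x ∉ U i := by
  simpa using h.notMem_not hx

theorem ne_one (h : IsFreeDecomposition K U) {i : Bool} {x : G} (hx : x ∈ U i) : x ≠ 1 := by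
  rintro rfl; exact h.one_notMem i hx

theorem mem_of_ne_one (h : IsFreeDecomposition K U) {i : Bool} {k : G} (hk : k ∈ K i)
    (hk1 : k ≠ 1) : k ∈ U i := by
  simpa using h.mul_mem hk hk1 (h.one_notMem i)

theorem mul_mem_of_mem_not (h : IsFreeDecomposition K U) {i : Bool} {k x : G} (hk : k ∈ K i)
    (hk1 : k ≠ 1) (hx : x ∈ U (!i)) : k * x ∈ U i :=
  h.mul_mem hk hk1 (h.notMem hx)

/-- Otherwise the non-trivial letter `k'⁻¹ * k` sends `x` into `U i`, yet its image is `x'`. -/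
theorem eq_of_mul_eq (h : IsFreeDecomposition K U) {i : Bool} {k k' x x' : G} (hk : k ∈ K i)
    (hk' : k' ∈ K i) (hx : x ∉ U i) (hx' : x' ∉ U i) (he : k * x = k' * x') : k = k' ∧ x = x' := by
  by_cases hkk : k = k'
  · subst hkk; exact ⟨rfl, mul_left_cancel he⟩
  · refine absurd (h.mul_mem (K i |>.mul_mem ((K i).inv_mem hk') hk) (fun h1 => hkk ?_) hx) ?_
    · exact (inv_mul_eq_one.mp h1).symm
    · rwa [mul_assoc, he, inv_mul_cancel_left]

/-- Left multiplication by a letter prepends it, merges it with the first letter, or cancels that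
letter. -/
theorem exists_hasWeight (h : IsFreeDecomposition K U) (s : Bool → G → ℤ) (x : G) :
    ∃ n, HasWeight K U s x n := by
  refine h.induction (fun x => ∃ n, HasWeight K U s x n) ⟨0, .one⟩ (fun i k hk x ⟨n, hn⟩ => ?_) x
  by_cases hk1 : k = 1
  · exact ⟨n, by simpa [hk1] using hn⟩
  cases hn with
  | one => exact ⟨_, by simpa using HasWeight.single i k hk hk1⟩
  | single j k' hk' hk1' =>
    obtain rfl | rfl : j = i ∨ j = !i := Bool.eq_or_eq_not j i
    · by_cases h1 : k * x = 1
      · exact ⟨0, h1 ▸ .one⟩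
      · exact ⟨_, .single j _ ((K j).mul_mem hk hk') h1⟩
    · exact ⟨_, .cons i k x _ hk hk1 (h.mem_of_ne_one hk' hk1') (.single _ x hk' hk1')⟩
  | cons j k' x m hk' hk1' hx hm =>
    obtain rfl | rfl : j = i ∨ j = !i := Bool.eq_or_eq_not j i
    · rw [← mul_assoc]
      by_cases h1 : k * k' = 1
      · exact ⟨m, by simpa [h1] using hm⟩
      · exact ⟨_, .cons j _ x m ((K j).mul_mem hk hk') h1 hx hm⟩
    · exact ⟨_, .cons i k _ _ hk hk1 (h.mul_mem_of_mem_not hk' hk1' hx)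
        (.cons _ k' x m hk' hk1' hx hm)⟩

/-- Induction on the normal form. -/
theorem letter_induction (h : IsFreeDecomposition K U) {motive : G → Prop} (one : motive 1)
    (single : ∀ i, ∀ k ∈ K i, k ≠ 1 → motive k)
    (cons : ∀ i, ∀ k ∈ K i, k ≠ 1 → ∀ x ∈ U (!i), motive x → motive (k * x)) (x : G) :
    motive x := by
  obtain ⟨n, hn⟩ := h.exists_hasWeight 0 x
  induction hn with
  | one => exact one
  | single i k hk hk1 => exact single i k hk hk1
  | cons i k x n hk hk1 hx _ ih => exact cons i k hk hk1 x hx ih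

theorem eq_of_mem (h : IsFreeDecomposition K U) {i j : Bool} {x : G} (hi : x ∈ U i)
    (hj : x ∈ U j) : j = i := by
  obtain rfl | rfl : j = i ∨ j = !i := Bool.eq_or_eq_not j i
  · rfl
  · exact absurd hj (h.notMem_not hi)

/-- The sets `U i` determine the factor of the first letter, and `eq_of_mul_eq` then determines that
letter and the remainder. -/
theorem hasWeight_unique (h : IsFreeDecomposition K U) {x : G} {n m : ℤ}
    (hn : HasWeight K U s x n) (hm : HasWeight K U s x m) : n = m := by
  induction hn generalizing m with
  | one =>
    generalize he : (1 : G) = x at hm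
    cases hm with
    | one => rfl
    | single j k hk hk1 => exact absurd he.symm hk1
    | cons j k x m hk hk1 hx hm =>
      exact absurd he.symm (h.ne_one (h.mul_mem_of_mem_not hk hk1 hx))
  | single i k hk hk1 =>
    have hkU := h.mem_of_ne_one hk hk1
    generalize he : k = x at hm
    cases hm with
    | one => exact absurd he hk1
    | single j k hk' hk1' =>
      subst he
      rw [h.eq_of_mem hkU (h.mem_of_ne_one hk' hk1')]
    | cons j k' x m hk' hk1' hx hm =>
      obtain rfl := h.eq_of_mem hkU (he ▸ h.mul_mem_of_mem_not hk' hk1' hx)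
      have := (h.eq_of_mul_eq hk hk' (h.one_notMem _) (h.notMem hx) ((mul_one k).trans he)).2
      exact absurd this.symm (h.ne_one hx)
  | cons i k x n hk hk1 hx hn ih =>
    have hkU := h.mul_mem_of_mem_not hk hk1 hx
    generalize he : k * x = y at hm
    cases hm with
    | one => exact absurd he (h.ne_one hkU)
    | single j k' hk' hk1' =>
      obtain rfl := h.eq_of_mem hkU (he ▸ h.mem_of_ne_one hk' hk1')
      have := (h.eq_of_mul_eq hk hk' (h.notMem hx) (h.one_notMem _) (he.trans (mul_one _).symm)).2
      exact absurd this (h.ne_one hx)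
    | cons j k' x' m hk' hk1' hx' hm =>
      obtain rfl := h.eq_of_mem hkU (he ▸ h.mul_mem_of_mem_not hk' hk1' hx')
      obtain ⟨rfl, rfl⟩ := h.eq_of_mul_eq hk hk' (h.notMem hx) (h.notMem hx') he
      rw [ih hm]

end IsFreeDecomposition

open Classical in
/-- The sum of the signs of the letters and of the orientations of the turns of the normal form. -/
noncomputable def weight {G : Type*} [Group G] (K : Bool → Subgroup G) (U : Bool → Set G)
    (s : Bool → G → ℤ) (g : G) : ℤ :=
  if h : ∃ n, HasWeight K U s g n then h.choose else 0

namespace IsFreeDecomposition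

variable {G : Type*} [Group G] {K : Bool → Subgroup G} {U : Bool → Set G} {s : Bool → G → ℤ}

theorem weight_eq (h : IsFreeDecomposition K U) {x : G} {n : ℤ} (hn : HasWeight K U s x n) :
    weight K U s x = n := by
  have hex : ∃ n, HasWeight K U s x n := ⟨n, hn⟩
  rw [weight, dif_pos hex]
  exact h.hasWeight_unique hex.choose_spec hn

theorem weight_one (h : IsFreeDecomposition K U) : weight K U s 1 = 0 := h.weight_eq .one

theorem weight_single (h : IsFreeDecomposition K U) {i : Bool} {k : G} (hk : k ∈ K i)
    (hk1 : k ≠ 1) : weight K U s k = s i k := h.weight_eq (.single i k hk hk1)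

theorem weight_cons (h : IsFreeDecomposition K U) {i : Bool} {k x : G} (hk : k ∈ K i)
    (hk1 : k ≠ 1) (hx : x ∈ U (!i)) :
    weight K U s (k * x) = s i k + weight K U s x + turn i := by
  obtain ⟨n, hn⟩ := h.exists_hasWeight s x
  rw [h.weight_eq hn, h.weight_eq (.cons i k x n hk hk1 hx hn)]

/-- An element of `U i` is a letter or a letter followed by an element of `U (!i)`. -/
theorem exists_letter (h : IsFreeDecomposition K U) {i : Bool} {x : G} (hx : x ∈ U i) :
    ∃ k ∈ K i, k ≠ 1 ∧ (x = k ∨ ∃ y ∈ U (!i), x = k * y) := by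
  obtain ⟨n, hn⟩ := h.exists_hasWeight 0 x
  cases hn with
  | one => exact absurd hx (h.one_notMem i)
  | single j k hk hk1 =>
    obtain rfl := h.eq_of_mem hx (h.mem_of_ne_one hk hk1)
    exact ⟨x, hk, hk1, Or.inl rfl⟩
  | cons j k y n hk hk1 hy hn =>
    obtain rfl := h.eq_of_mem hx (h.mul_mem_of_mem_not hk hk1 hy)
    exact ⟨k, hk, hk1, Or.inr ⟨y, hy, rfl⟩⟩

/-- The properties of the signs of the letters that are used. -/
structure IsSign (K : Bool → Subgroup G) (s : Bool → G → ℤ) : Prop where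
  eq_or : ∀ {i k}, k ∈ K i → k ≠ 1 → s i k = 1 ∨ s i k = -1
  inv : ∀ {i k}, k ∈ K i → k ≠ 1 → s i k⁻¹ = - s i k
  triple : ∀ {i k l}, k ∈ K i → l ∈ K i → k ≠ 1 → l ≠ 1 → k ≠ l →
    s i (k⁻¹ * l) - s i l + s i k = 1 ∨ s i (k⁻¹ * l) - s i l + s i k = -1

/-- The weight of a product without cancellation. -/
theorem weight_inv_mul (h : IsFreeDecomposition K U) (hs : IsSign K s) {i : Bool} {x u : G}
    (hx : x ∈ U i) (hu : u ∈ U (!i)) :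
    weight K U s (x⁻¹ * u) = - weight K U s x + weight K U s u + turn i := by
  induction x using h.letter_induction generalizing i u with
  | one => exact absurd hx (h.one_notMem i)
  | single j k hk hk1 =>
    obtain rfl := h.eq_of_mem hx (h.mem_of_ne_one hk hk1)
    rw [h.weight_cons ((K _).inv_mem hk) (inv_ne_one.mpr hk1) hu, h.weight_single hk hk1,
      hs.inv hk hk1]
  | cons j k hk hk1 y hy ih =>
    obtain rfl := h.eq_of_mem hx (h.mul_mem_of_mem_not hk hk1 hy)
    have hk' := (K j).inv_mem hk
    have hk1' := inv_ne_one.mpr hk1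
    -- Moving `k⁻¹` onto `u` shortens `x`. Inversion negates letter signs and turns; the only new
    -- term is the turn at the junction.
    rw [mul_inv_rev, mul_assoc, ih hy (by simpa using h.mul_mem_of_mem_not hk' hk1' hu),
      h.weight_cons hk' hk1' hu, h.weight_cons hk hk1 hy, hs.inv hk hk1, turn_not]
    ring

theorem weight_inv (h : IsFreeDecomposition K U) (hs : IsSign K s) (x : G) :
    weight K U s x⁻¹ = - weight K U s x := by
  by_cases hx1 : x = 1
  · simp [hx1, h.weight_one]
  obtain ⟨i, hx⟩ : ∃ i, x ∈ U i := (h.mem_or hx1 true).elim (⟨_, ·⟩) (⟨_, ·⟩)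
  obtain ⟨k, hk, hk1, rfl | ⟨y, hy, rfl⟩⟩ := h.exists_letter hx
  · rw [h.weight_single hk hk1, h.weight_single ((K i).inv_mem hk) (inv_ne_one.mpr hk1),
      hs.inv hk hk1]
  · have hk' := (K i).inv_mem hk
    have hk1' := inv_ne_one.mpr hk1
    rw [mul_inv_rev, h.weight_inv_mul hs hy (by simpa using h.mem_of_ne_one hk' hk1'),
      h.weight_single hk' hk1', h.weight_cons hk hk1 hy, hs.inv hk hk1, turn_not]
    ring

/-- A normal form with `n` letters has `n - 1` turns, so the weight is a sum of `2n - 1` signs. -/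
theorem weight_odd (h : IsFreeDecomposition K U) (hs : IsSign K s) {x : G} (hx1 : x ≠ 1) :
    Odd (weight K U s x) := by
  have hodd : ∀ {n : ℤ}, n = 1 ∨ n = -1 → Odd n := by rintro n (rfl | rfl) <;> decide
  induction x using h.letter_induction with
  | one => exact absurd rfl hx1
  | single i k hk hk1 => rw [h.weight_single hk hk1]; exact hodd (hs.eq_or hk hk1)
  | cons i k hk hk1 y hy ih =>
    rw [h.weight_cons hk hk1 hy]
    exact ((hodd (hs.eq_or hk hk1)).add_odd (ih (h.ne_one hy))).add_odd (hodd (turn_eq_or i))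

/-- The weight is a quasimorphism of defect one away from the identity. -/
theorem weight_triple (h : IsFreeDecomposition K U) (hs : IsSign K s) {x y : G} (hx1 : x ≠ 1)
    (hy1 : y ≠ 1) (hxy : x ≠ y) :
    weight K U s (x⁻¹ * y) - weight K U s y + weight K U s x = 1 ∨
      weight K U s (x⁻¹ * y) - weight K U s y + weight K U s x = -1 := by
  -- Common initial letters cancel, leaving only what happens where `x` and `y` diverge: a single
  -- turn if they continue in different factors or one is a prefix of the other, and the sign triple
  -- of two distinct letters if they continue in the same factor.
  induction x using h.letter_induction generalizing y with
  | one => exact absurd rfl hx1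
  | single i k hk hk1 =>
    have hkU := h.mem_of_ne_one hk hk1
    rcases h.mem_or hy1 i with hy | hy
    · obtain ⟨l, hl, hl1, rfl | ⟨z, hz, rfl⟩⟩ := h.exists_letter hy
      · rw [h.weight_single ((K i).mul_mem ((K i).inv_mem hk) hl) (inv_mul_eq_one.not.mpr hxy),
          h.weight_single hl hl1, h.weight_single hk hk1]
        exact hs.triple hk hl hk1 hl1 hxy
      · by_cases hkl : k = l
        · subst hkl
          rw [inv_mul_cancel_left, h.weight_cons hk hk1 hz, h.weight_single hk hk1]
          have := turn_eq_or i
          omega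
        · rw [← mul_assoc, h.weight_cons ((K i).mul_mem ((K i).inv_mem hk) hl)
            (inv_mul_eq_one.not.mpr hkl) hz, h.weight_cons hl hl1 hz, h.weight_single hk hk1]
          have := hs.triple hk hl hk1 hl1 hkl
          omega
    · rw [h.weight_inv_mul hs hkU hy]
      have := turn_eq_or i
      omega
  | cons i k hk hk1 x hx ih =>
    have hkU := h.mul_mem_of_mem_not hk hk1 hx
    rcases h.mem_or hy1 i with hy | hy
    · obtain ⟨l, hl, hl1, hlz⟩ := h.exists_letter hy
      by_cases hkl : k = l
      · subst hkl
        obtain rfl | ⟨z, hz, rfl⟩ := hlz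
        · rw [mul_inv_rev, inv_mul_cancel_right, h.weight_inv hs, h.weight_cons hk hk1 hx,
            h.weight_single hk hk1]
          have := turn_eq_or i
          omega
        · have := ih (h.ne_one hx) (h.ne_one hz) (fun he => hxy (by rw [he]))
          rw [mul_inv_rev, mul_assoc, inv_mul_cancel_left, h.weight_cons hk hk1 hx,
            h.weight_cons hk hk1 hz]
          omega
      · have hkl' := (K i).mul_mem ((K i).inv_mem hk) hl
        have hkl1 : k⁻¹ * l ≠ 1 := inv_mul_eq_one.not.mpr hkl
        have ht := hs.triple hk hl hk1 hl1 hkl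
        have htn := turn_not i
        obtain rfl | ⟨z, hz, rfl⟩ := hlz
        · rw [mul_inv_rev, mul_assoc,
            h.weight_inv_mul hs hx (by simpa using h.mem_of_ne_one hkl' hkl1),
            h.weight_single hkl' hkl1, h.weight_single hl hl1, h.weight_cons hk hk1 hx]
          omega
        · rw [mul_inv_rev, mul_assoc, ← mul_assoc k⁻¹,
            h.weight_inv_mul hs hx (by simpa using h.mul_mem_of_mem_not hkl' hkl1 hz),
            h.weight_cons hkl' hkl1 hz, h.weight_cons hl hl1 hz, h.weight_cons hk hk1 hx]
          omega
    · rw [h.weight_inv_mul hs hkU hy]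
      have := turn_eq_or i
      omega

/-- The elements of positive weight form a positive cone. -/
theorem isPositiveCone_weight (h : IsFreeDecomposition K U) (hs : IsSign K s) :
    IsPositiveCone {x | 0 < weight K U s x} where
  mul_mem {a b} ha hb := by
    simp only [Set.mem_ofPred_eq] at ha hb ⊢
    have hne : ∀ {x : G}, 0 < weight K U s x → x ≠ 1 := by
      rintro x hx rfl
      rw [h.weight_one] at hx
      exact lt_irrefl _ hx
    have hab : a * b ≠ 1 := fun h1 => by
      rw [← inv_eq_of_mul_eq_one_right h1, h.weight_inv hs] at hb
      omega
    -- With `x = a` and `y = a * b`, the weight of `a * b` is at least the sum of two positive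
    -- weights minus one.
    have := h.weight_triple hs (hne ha) hab (by simpa using hne hb)
    rw [inv_mul_cancel_left] at this
    omega
  one_notMem := by simp [h.weight_one]
  disjoint_inv := Set.disjoint_left.mpr fun x hx hx' => by
    simp only [Set.mem_inv, Set.mem_ofPred_eq, h.weight_inv hs] at hx hx'
    omega
  union_eq := by
    ext x
    by_cases hx1 : x = 1
    · simp [hx1]
    · have h0 : weight K U s x ≠ 0 := fun h0 => by simpa [h0] using h.weight_odd hs hx1
      have := h0.lt_or_gt.symm
      simpa [hx1, h.weight_inv hs] using this

end IsFreeDecomposition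

/-! ### Left-orderability of the free product -/

open Monoid.Coprod

variable {A B : Type*} [Group A] [Group B]

variable (A B) in
/-- The free factors of `A * B`. -/
def factor (i : Bool) : Subgroup (Monoid.Coprod A B) :=
  if i then (inl : A →* Monoid.Coprod A B).range else (inr : B →* Monoid.Coprod A B).range

variable (A B) in
/-- The elements of `A * B` whose normal form begins with a letter of a given factor. -/
def starts (i : Bool) : Set (Monoid.Coprod A B) :=
  if i then startsInl A B else {x | x ≠ 1 ∧ x ∉ startsInl A B}

theorem isFreeDecomposition_coprod : IsFreeDecomposition (factor A B) (starts A B) where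
  one_notMem i := by cases i <;> simp [starts, one_notMem_startsInl]
  notMem_not {i x} hx := by cases i <;> simp_all [starts]
  mem_or {x} hx i := by
    cases i <;> simp only [starts] <;> simp <;> tauto
  mul_mem {i k x} hk hk1 hx := by
    cases i
    · obtain ⟨b, rfl⟩ : ∃ b, inr b = k := hk
      have hb : b ≠ 1 := (map_ne_one_iff _ inr_injective).mp hk1
      by_cases hx1 : x = 1
      · subst hx1
        simpa [starts, hb, map_ne_one_iff _ (inr_injective (M := A) (N := B))] using
          inr_notMem_startsInl b
      · have hxU : x ∈ startsInl A B := by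
          by_contra hxU
          exact hx ⟨hx1, hxU⟩
        refine ⟨fun h1 => ?_, inr_mul_notMem_startsInl hb hxU⟩
        rw [← inv_eq_of_mul_eq_one_right h1, ← map_inv] at hxU
        exact inr_notMem_startsInl _ hxU
    · obtain ⟨a, rfl⟩ : ∃ a, inl a = k := hk
      exact inl_mul_mem_startsInl ((map_ne_one_iff _ inl_injective).mp hk1) hx
  induction motive one mul x := by
    induction x using induction_on' with
    | one => exact one
    | inl_mul a x ih => exact mul true _ ⟨a, rfl⟩ x ih
    | inr_mul b x ih => exact mul false _ ⟨b, rfl⟩ x ih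

/-- The signs of the letters of `A * B` with respect to positive cones of the factors. -/
noncomputable def letterSign (P : Set A) (Q : Set B) (i : Bool) (x : Monoid.Coprod A B) : ℤ :=
  if i then coneSign P (fst x) else coneSign Q (snd x)

theorem isSign_letterSign {P : Set A} {Q : Set B} (hP : IsPositiveCone P)
    (hQ : IsPositiveCone Q) :
    IsFreeDecomposition.IsSign (factor A B) (letterSign P Q) where
  eq_or {i k} hk hk1 := by
    cases i
    · obtain ⟨b, rfl⟩ : ∃ b, inr b = k := hk
      have := coneSign_eq_or hQ ((map_ne_one_iff _ (inr_injective (M := A))).mp hk1)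
      simp only [letterSign, snd_apply_inr]
      tauto
    · obtain ⟨a, rfl⟩ : ∃ a, inl a = k := hk
      have := coneSign_eq_or hP ((map_ne_one_iff _ (inl_injective (N := B))).mp hk1)
      simp only [letterSign, fst_apply_inl]
      tauto
  inv {i k} hk hk1 := by
    cases i
    · obtain ⟨b, rfl⟩ : ∃ b, inr b = k := hk
      simpa [letterSign] using
        coneSign_inv hQ ((map_ne_one_iff _ (inr_injective (M := A))).mp hk1)
    · obtain ⟨a, rfl⟩ : ∃ a, inl a = k := hk
      simpa [letterSign] using
        coneSign_inv hP ((map_ne_one_iff _ (inl_injective (N := B))).mp hk1)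
  triple {i k l} hk hl hk1 hl1 hkl := by
    cases i
    · obtain ⟨b, rfl⟩ : ∃ b, inr b = k := hk
      obtain ⟨c, rfl⟩ : ∃ c, inr c = l := hl
      simpa [letterSign] using
        coneSign_triple hQ ((map_ne_one_iff _ (inr_injective (M := A))).mp hk1)
          ((map_ne_one_iff _ (inr_injective (M := A))).mp hl1) (fun h => hkl (by rw [h]))
    · obtain ⟨b, rfl⟩ : ∃ b, inl b = k := hk
      obtain ⟨c, rfl⟩ : ∃ c, inl c = l := hl
      simpa [letterSign] using
        coneSign_triple hP ((map_ne_one_iff _ (inl_injective (N := B))).mp hk1)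
          ((map_ne_one_iff _ (inl_injective (N := B))).mp hl1) (fun h => hkl (by rw [h]))

/-- The free product of left-orderable groups is left-orderable (Vinogradov). -/
theorem coprod_isLeftOrderable (hA : IsLeftOrderable A) (hB : IsLeftOrderable B) :
    IsLeftOrderable (Monoid.Coprod A B) :=
  let ⟨_, hP⟩ := hA
  let ⟨_, hQ⟩ := hB
  ⟨_, isFreeDecomposition_coprod.isPositiveCone_weight (isSign_letterSign hP hQ)⟩

end Hucha

theorem mainTheorem5 (A : Type*) (B : Type*) [Group A] [Group B] [Nontrivial A] [Nontrivial B]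
    [Group.FG A] [Group.FG B] :
    (Hucha.IsLeftOrderable A → Hucha.IsLeftOrderable B →
      Hucha.IsHucha (Monoid.Coprod A B)
        ({(Monoid.Coprod.inl : A →* Monoid.Coprod A B).range,
          (Monoid.Coprod.inr : B →* Monoid.Coprod A B).range} ∪
          {C : Subgroup (Monoid.Coprod A B) | IsCyclic C})) ∧
    (∀ X : Set (Monoid.Coprod A B), Hucha.IsFiniteGenSet X →
      ∀ P : Set (Monoid.Coprod A B), Hucha.IsPositiveCone P →
        ¬ Hucha.CoarselyConnected (SimpleGraph.mulCayley X) P) := by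
  refine ⟨fun hA hB => ⟨Hucha.coprod_fg, Hucha.coprod_isLeftOrderable hA hB,
    fun X hX => Hucha.coprod_graphIsHucha hX.1⟩, fun X hX P hP =>
    hP.not_coarselyConnected (Hucha.exists_negativeSwamp_range_inl hX.1 hP)⟩
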